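/- Let $\mathcal X\subset\mathbb R^p$ and $\mathcal Y\subset\mathbb R^q$ be closed convex sets, let $\rho>0$, and let $f:\mathbb R^p\times\mathbb R^q\to\mathbb R$ be continuous on $\mathcal Z=\mathcal X\times\mathcal Y$. For $h:\mathbb R^d\to\mathbb R$ let $$\partial h(x)=\{\zeta\in\mathbb R^d : h(x')\ge h(x)+\zeta^\top(x'-x)+o(\|x'-x\|)\ \text{ as } x'\to x\}$$ be its Fréchet subdifferential, and for $z=(x,y)$ put $F(z)=\partial_x f(x,y)\times\partial_y[-f(x,y)]\subset\mathbb R^{p+q}$, where $\partial_x$ and $\partial_y$ are the Fréchet subdifferentials with respect to $x\in\mathbb R^p$ and $y\in\mathbb R^q$ with the other variable fixed. We say that - $f$ is $\rho$-weakly-convex-weakly-concave if for every $y\in\mathcal Y$ the function $x\mapsto f(x,y)+\frac\rho2\|x\|^2$ is convex on $\mathcal X$, and for every $x\in\mathcal X$ the function $y\mapsto f(x,y)-\frac\rho2\|y\|^2$ is concave on $\mathcal Y$; - $F$ is $\rho$-weakly monotone if $\langle\xi-\xi',z-z'\rangle\ge-\rho\|z-z'\|^2$ for all $z,z'\in\mathcal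 Z$, $\xi\in F(z)$, $\xi'\in F(z')$. If $f$ is $\rho$-weakly-convex-weakly-concave, then $F$ is $\rho$-weakly monotone. Conversely, if $F(z)\neq\emptyset$ for every $z=(x,y)$ with $x$ in the relative interior of $\mathcal X$ and $y$ in the relative interior of $\mathcal Y$ (in particular, if $F(z)\ne\emptyset$ for all $z\in\mathcal Z$), and $F$ is $\rho$-weakly monotone, then $f$ is $\rho$-weakly-convex-weakly-concave. Thus, whenever $F$ has nonempty values on $\mathcal Z$, $f$ is $\rho$-weakly-convex-weakly-concave if and only if $F$ is $\rho$-weakly monotone. -/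

import Mathlib

open Topology

section Defs

variable {E F H : Type*}
  [NormedAddCommGroup E] [InnerProductSpace ℝ E]
  [NormedAddCommGroup F] [InnerProductSpace ℝ F]
  [NormedAddCommGroup H] [InnerProductSpace ℝ H]

/-- The Fréchet subdifferential of a real-valued function `h` at `x`: the vectors `ζ` with
`h x' ≥ h x + ⟪ζ, x' - x⟫ + o(‖x' - x‖)` as `x' → x`. -/
def frechetSubdifferential (h : E → ℝ) (x : E) : Set E :=
  {ζ | ∀ ε : ℝ, 0 < ε → ∀ᶠ x' in 𝓝 x, h x + inner ℝ ζ (x' - x) - ε * ‖x' - x‖ ≤ h x'}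

/-- The set-valued mapping `G` is `ρ`-weakly monotone on the set `Z`. -/
def IsWeaklyMonotoneOn (ρ : ℝ) (Z : Set H) (G : H → Set H) : Prop :=
  ∀ z ∈ Z, ∀ z' ∈ Z, ∀ ξ ∈ G z, ∀ ξ' ∈ G z',
    -ρ * ‖z - z'‖ ^ 2 ≤ inner ℝ (ξ - ξ') (z - z')

/-- `f` is `ρ`-weakly-convex-weakly-concave on `X × Y`. -/
def IsWeaklyConvexWeaklyConcaveOn (ρ : ℝ) (X : Set E) (Y : Set F) (f : E → F → ℝ) : Prop :=
  (∀ y ∈ Y, ConvexOn ℝ X (fun x => f x y + ρ / 2 * ‖x‖ ^ 2)) ∧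
    (∀ x ∈ X, ConcaveOn ℝ Y (fun y => f x y - ρ / 2 * ‖y‖ ^ 2))

/-- The product `X × Y` inside the Euclidean (`ℓ²`) product of the two spaces. -/
def prodSet (X : Set E) (Y : Set F) : Set (WithLp 2 (E × F)) :=
  {z | z.fst ∈ X ∧ z.snd ∈ Y}

/-- The set-valued mapping `(x, y) ↦ ∂ₓ f(x, y) × ∂_y [-f(x, y)]`, with values in the
Euclidean (`ℓ²`) product of the two spaces. -/
def saddleMapping (f : E → F → ℝ) (z : WithLp 2 (E × F)) : Set (WithLp 2 (E × F)) :=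
  prodSet (frechetSubdifferential (fun x => f x z.snd) z.fst)
    (frechetSubdifferential (fun y => -f z.fst y) z.snd)

end Defs

open Set Filter

/-! Adding `ρ / 2 * ‖x‖ ^ 2` shifts Fréchet subgradients at `x` by `ρ • x`, which reduces weak
convexity and weak monotonicity to the ordinary notions. If `f` is weakly convex-concave, Fréchet
subgradients are global up to a quadratic term. Four such inequalities, in each variable at `z` and
`z'`, are added, and the values of `f` at the four corners cancel. Conversely, comparing points with
a common coordinate makes each partial subdifferential weakly monotone. A mean value inequality
along segments turns its elements into global subgradients
(`add_inner_le_of_monotone_frechetSubdifferential`), whence convexity on the relative interiors;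
continuity extends it to `X` and `Y`. -/

/-! ### Relative interiors of convex sets -/

theorem mem_intrinsicInterior_iff_nhdsWithin {E : Type*} [NormedAddCommGroup E]
    [InnerProductSpace ℝ E] {s : Set E} {x : E} :
    x ∈ intrinsicInterior ℝ s ↔
      x ∈ affineSpan ℝ s ∧ s ∈ 𝓝[(affineSpan ℝ s : Set E)] x := by
  rw [mem_intrinsicInterior]
  constructor
  · rintro ⟨y, hy, rfl⟩
    rw [mem_interior_iff_mem_nhds] at hy
    exact ⟨y.2, preimage_coe_mem_nhds_subtype.1 hy⟩
  · rintro ⟨hx, h⟩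
    exact ⟨⟨x, hx⟩, mem_interior_iff_mem_nhds.2 (preimage_coe_mem_nhds_subtype.2 h), rfl⟩

/-- The homothety of centre `x` and ratio `t⁻¹` preserves the affine span and sends the given point
to `y`, so it pulls a relative neighbourhood of `y` back to one of that point. -/
theorem Convex.lineMap_mem_intrinsicInterior {E : Type*} [NormedAddCommGroup E]
    [InnerProductSpace ℝ E] {s : Set E} (hs : Convex ℝ s) {x y : E} (hx : x ∈ s)
    (hy : y ∈ intrinsicInterior ℝ s) {t : ℝ} (ht : t ∈ Ioc (0 : ℝ) 1) :
    AffineMap.lineMap x y t ∈ intrinsicInterior ℝ s := by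
  rw [mem_intrinsicInterior_iff_nhdsWithin] at hy ⊢
  have hxA : x ∈ affineSpan ℝ s := subset_affineSpan ℝ s hx
  have ht0 : t ≠ 0 := ht.1.ne'
  refine ⟨AffineMap.lineMap_mem t hxA hy.1, ?_⟩
  have hcont : Continuous fun w : E => AffineMap.lineMap x w t⁻¹ := by
    simp only [AffineMap.lineMap_apply_module']
    fun_prop
  have hval : AffineMap.lineMap x (AffineMap.lineMap x y t : E) t⁻¹ = y := by
    simp [AffineMap.lineMap_apply_module', smul_smul, ht0]
  have hlim : Tendsto (fun w : E => AffineMap.lineMap x w t⁻¹)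
      (𝓝[(affineSpan ℝ s : Set E)] (AffineMap.lineMap x y t))
      (𝓝[(affineSpan ℝ s : Set E)] y) := by
    have := hcont.continuousWithinAt (s := (affineSpan ℝ s : Set E))
      (x := AffineMap.lineMap x y t) |>.tendsto_nhdsWithin
        (t := (affineSpan ℝ s : Set E)) fun w hw => AffineMap.lineMap_mem _ hxA hw
    rwa [hval] at this
  filter_upwards [hlim.eventually hy.2] with w hw
  have : AffineMap.lineMap x (AffineMap.lineMap x w t⁻¹ : E) t = w := by
    simp [AffineMap.lineMap_apply_module', smul_smul, ht0]
  exact this ▸ hs.lineMap_mem hx hw ⟨ht.1.le, ht.2⟩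

theorem Convex.intrinsicInterior_convex {E : Type*} [NormedAddCommGroup E]
    [InnerProductSpace ℝ E] {s : Set E} (hs : Convex ℝ s) :
    Convex ℝ (intrinsicInterior ℝ s) := by
  rw [convex_iff_forall_pos]
  intro x hx y hy a b ha hb hab
  have := hs.lineMap_mem_intrinsicInterior (intrinsicInterior_subset hx) hy
    (t := b) ⟨hb, by linarith⟩
  rwa [AffineMap.lineMap_apply_module, show 1 - b = a by linarith] at this

/-! ### Fréchet subgradients and convexity -/

section Subdifferential

variable {E F : Type*} [NormedAddCommGroup E] [InnerProductSpace ℝ E]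
  [NormedAddCommGroup F] [InnerProductSpace ℝ F]

theorem frechetSubdifferential_add_sq {g : E → ℝ} {x ζ : E}
    (h : ζ ∈ frechetSubdifferential g x) (ρ : ℝ) :
    ζ + ρ • x ∈ frechetSubdifferential (fun u => g u + ρ / 2 * ‖u‖ ^ 2) x := by
  intro ε hε
  have hlim : Tendsto (fun u : E => |ρ| * ‖u - x‖) (𝓝 x) (𝓝 0) := by
    have : Continuous fun u : E => |ρ| * ‖u - x‖ := by fun_prop
    simpa using this.tendsto x
  -- The other `ε / 2` absorbs the quadratic remainder `ρ / 2 * ‖u - x‖ ^ 2`.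
  filter_upwards [h _ (half_pos hε), hlim.eventually (gt_mem_nhds hε)] with u hu hsmall
  have hsq : ‖u‖ ^ 2 = ‖x‖ ^ 2 + 2 * inner ℝ x (u - x) + ‖u - x‖ ^ 2 := by
    simpa using norm_add_sq_real x (u - x)
  rw [inner_add_left, real_inner_smul_left, hsq]
  nlinarith [mul_nonneg (sub_nonneg.2 (neg_abs_le ρ)) (sq_nonneg ‖u - x‖),
    mul_le_mul_of_nonneg_right hsmall.le (norm_nonneg (u - x))]

theorem eventually_le_of_mem_frechetSubdifferential {h : E → ℝ} {x ζ : E}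
    (hζ : ζ ∈ frechetSubdifferential h x) (d : E) {r : ℝ} (hr : 0 < r) :
    ∀ᶠ t in 𝓝[>] (0 : ℝ), h x + t * (inner ℝ ζ d - r) ≤ h (x + t • d) := by
  have hlim : Tendsto (fun t : ℝ => x + t • d) (𝓝[>] 0) (𝓝 x) := by
    have : Continuous fun t : ℝ => x + t • d := by fun_prop
    simpa using (this.tendsto 0).mono_left nhdsWithin_le_nhds
  have hε : 0 < r / (‖d‖ + 1) := by positivity
  filter_upwards [hlim.eventually (hζ _ hε), self_mem_nhdsWithin] with t ht ht0
  have ht0 : 0 < t := ht0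
  rw [add_sub_cancel_left, real_inner_smul_right, norm_smul, Real.norm_of_nonneg ht0.le] at ht
  have hle : r / (‖d‖ + 1) * ‖d‖ ≤ r := by
    rw [div_mul_eq_mul_div, div_le_iff₀ (by positivity)]
    nlinarith
  nlinarith [mul_le_mul_of_nonneg_left hle ht0.le]

/-- Convexity bounds the increment of `h` over a short initial piece of the segment above, the
subgradient bounds it below; divide by `t`. -/
theorem ConvexOn.add_inner_le_of_mem_frechetSubdifferential {h : E → ℝ} {X : Set E}
    (hh : ConvexOn ℝ X h) {x x' ζ : E} (hx : x ∈ X) (hx' : x' ∈ X)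
    (hζ : ζ ∈ frechetSubdifferential h x) :
    h x + inner ℝ ζ (x' - x) ≤ h x' := by
  refine le_of_forall_pos_le_add fun r hr => ?_
  obtain ⟨t, ht, ht1⟩ := ((eventually_le_of_mem_frechetSubdifferential hζ (x' - x) hr).and
    (Ioc_mem_nhdsGT (zero_lt_one (α := ℝ)))).exists
  have hc := hh.2 hx hx' (sub_nonneg.2 ht1.2) ht1.1.le (sub_add_cancel 1 t)
  have he : (1 - t) • x + t • x' = x + t • (x' - x) := by module
  rw [he, smul_eq_mul, smul_eq_mul] at hc
  have : t * (h x + inner ℝ ζ (x' - x)) ≤ t * (h x' + r) := by linarith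
  exact le_of_mul_le_mul_left this ht1.1

/-- If the Fréchet subdifferential is nonempty-valued and monotone on a convex set, then each of its
elements is a global subgradient on that set. -/
theorem add_inner_le_of_monotone_frechetSubdifferential {h : E → ℝ} {S : Set E}
    (hS : Convex ℝ S) (hc : ContinuousOn h S)
    (hne : ∀ x ∈ S, (frechetSubdifferential h x).Nonempty)
    (hm : ∀ x ∈ S, ∀ x' ∈ S, ∀ ζ ∈ frechetSubdifferential h x,
      ∀ ζ' ∈ frechetSubdifferential h x', 0 ≤ inner ℝ (ζ - ζ') (x - x'))
    {x x' ζ : E} (hx : x ∈ S) (hx' : x' ∈ S) (hζ : ζ ∈ frechetSubdifferential h x) :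
    h x + inner ℝ ζ (x' - x) ≤ h x' := by
  set d := x' - x with hd
  have hmem : ∀ t ∈ Icc (0 : ℝ) 1, x + t • d ∈ S := fun t ht => by
    have := hS.lineMap_mem hx hx' ht
    rwa [AffineMap.lineMap_apply_module', add_comm] at this
  have hcont : ContinuousOn (fun t : ℝ => h (x + t • d)) (Icc 0 1) :=
    hc.comp (by fun_prop) hmem
  -- Monotonicity between `x + t • d` and `x`, divided by `t`.
  have hsub : ∀ t ∈ Icc (0 : ℝ) 1, ∃ η ∈ frechetSubdifferential h (x + t • d),
      (inner ℝ ζ d : ℝ) ≤ inner ℝ η d := by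
    intro t ht
    rcases ht.1.eq_or_lt with rfl | h0
    · exact ⟨ζ, by simpa using hζ, le_rfl⟩
    · obtain ⟨η, hη⟩ := hne _ (hmem t ht)
      refine ⟨η, hη, ?_⟩
      have := hm _ (hmem t ht) x hx η hη ζ hζ
      rw [add_sub_cancel_left, real_inner_smul_right, inner_sub_left] at this
      linarith [nonneg_of_mul_nonneg_right this h0]
  -- No derivative of `h` is needed: the right slopes of `t * ⟪ζ, d⟫ - h (x + t • d)` are eventually
  -- below every `r > 0`, so it never exceeds its initial value `-h x`.
  have key := image_le_of_liminf_slope_right_le_deriv_boundary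
    (f := fun t : ℝ => t * inner ℝ ζ d - h (x + t • d)) (a := 0) (b := 1)
    (B := fun _ => -h x) (B' := fun _ => 0)
    ((continuousOn_id.mul continuousOn_const).sub hcont) (by simp) continuousOn_const
    (fun t _ => hasDerivWithinAt_const t _ _) ?_ (right_mem_Icc.2 zero_le_one)
  · simp only [one_smul, one_mul, hd, add_sub_cancel] at key
    linarith
  intro t ht r hr
  obtain ⟨η, hη, hle⟩ := hsub t ⟨ht.1, ht.2.le⟩
  refine Eventually.frequently ?_
  have hlim : Tendsto (fun z : ℝ => z - t) (𝓝[>] t) (𝓝[>] 0) := by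
    have hcz : ContinuousWithinAt (fun z : ℝ => z - t) (Ioi t) t := by fun_prop
    have := hcz.tendsto_nhdsWithin (t := Ioi 0) fun z hz => sub_pos.2 hz
    simpa using this
  filter_upwards [hlim.eventually
    (eventually_le_of_mem_frechetSubdifferential hη d (half_pos hr)), self_mem_nhdsWithin]
    with z hz htz
  have htz : 0 < z - t := sub_pos.2 htz
  have he : x + t • d + (z - t) • d = x + z • d := by module
  rw [he] at hz
  rw [slope_def_field, div_lt_iff₀ htz]
  nlinarith [mul_le_mul_of_nonneg_left hle htz.le, mul_pos htz hr]

/-- In the weighted sum of the subgradient inequalities based at `a • x + b • y`, the linear terms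
cancel. -/
theorem convexOn_of_monotone_frechetSubdifferential {h : E → ℝ} {S : Set E}
    (hS : Convex ℝ S) (hc : ContinuousOn h S)
    (hne : ∀ x ∈ S, (frechetSubdifferential h x).Nonempty)
    (hm : ∀ x ∈ S, ∀ x' ∈ S, ∀ ζ ∈ frechetSubdifferential h x,
      ∀ ζ' ∈ frechetSubdifferential h x', 0 ≤ inner ℝ (ζ - ζ') (x - x')) :
    ConvexOn ℝ S h := by
  refine ⟨hS, fun x hx y hy a b ha hb hab => ?_⟩
  have hz := hS hx hy ha hb hab
  obtain ⟨ζ, hζ⟩ := hne _ hz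
  set z := a • x + b • y with hzdef
  have h1 := add_inner_le_of_monotone_frechetSubdifferential hS hc hne hm hz hx hζ
  have h2 := add_inner_le_of_monotone_frechetSubdifferential hS hc hne hm hz hy hζ
  have h0 : a * inner ℝ ζ (x - z) + b * inner ℝ ζ (y - z) = 0 := by
    rw [← real_inner_smul_right, ← real_inner_smul_right, ← inner_add_right]
    have : a • (x - z) + b • (y - z) = (1 - (a + b)) • z := by rw [hzdef]; module
    rw [this, hab, sub_self, zero_smul, inner_zero_right]
  have h3 : h z = a * h z + b * h z := by rw [← add_mul, hab, one_mul]
  simp only [smul_eq_mul]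
  nlinarith [mul_le_mul_of_nonneg_left h1 ha, mul_le_mul_of_nonneg_left h2 hb]

/-- If the partial functions of a continuous function `f` on `X × Y` are convex on the relative
interior of `X` for all parameters in the relative interior of `Y`, then they are convex on `X`
for all parameters in `Y`. -/
theorem convexOn_of_convexOn_intrinsicInterior [FiniteDimensional ℝ E] [FiniteDimensional ℝ F]
    {X : Set E} {Y : Set F} (hX : Convex ℝ X) (hY : Convex ℝ Y) {f : E → F → ℝ}
    (hf : ContinuousOn (fun w : E × F => f w.1 w.2) (X ×ˢ Y))
    (hconv : ∀ y ∈ intrinsicInterior ℝ Y, ConvexOn ℝ (intrinsicInterior ℝ X) fun x => f x y)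
    {y : F} (hy : y ∈ Y) : ConvexOn ℝ X fun x => f x y := by
  refine ⟨hX, fun x hx x' hx' a b ha hb hab => ?_⟩
  -- Points and parameter are moved towards `x₀` and `y₀` by the same `t`, where convexity is known;
  -- then `t → 0`.
  obtain ⟨x₀, hx₀⟩ := Set.Nonempty.intrinsicInterior hX ⟨x, hx⟩
  obtain ⟨y₀, hy₀⟩ := Set.Nonempty.intrinsicInterior hY ⟨y, hy⟩
  have hIoc : Ioc (0 : ℝ) 1 ∈ 𝓝[>] (0 : ℝ) := Ioc_mem_nhdsGT zero_lt_one
  have hlim : ∀ u ∈ X, ∀ φ : ℝ → E, Continuous φ → φ 0 = u →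
      (∀ t ∈ Ioc (0 : ℝ) 1, φ t ∈ X) →
      Tendsto (fun t => f (φ t) (AffineMap.lineMap y y₀ t)) (𝓝[>] 0) (𝓝 (f u y)) := by
    intro u hu φ hφ hφ0 hφX
    have hpath : Tendsto (fun t : ℝ => (φ t, (AffineMap.lineMap y y₀ t : F))) (𝓝[>] 0)
        (𝓝 (u, y)) := by
      have hc : Continuous fun t : ℝ => (φ t, (AffineMap.lineMap y y₀ t : F)) :=
        hφ.prodMk (AffineMap.lineMap_continuous)
      simpa [hφ0] using (hc.tendsto 0).mono_left nhdsWithin_le_nhds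
    refine (hf (u, y) ⟨hu, hy⟩).tendsto.comp (tendsto_nhdsWithin_iff.2 ⟨hpath, ?_⟩)
    filter_upwards [hIoc] with t ht
    exact ⟨hφX t ht, hY.lineMap_mem hy (intrinsicInterior_subset hy₀) ⟨ht.1.le, ht.2⟩⟩
  have hri : ∀ u ∈ X, ∀ t ∈ Ioc (0 : ℝ) 1,
      AffineMap.lineMap u x₀ t ∈ intrinsicInterior ℝ X :=
    fun u hu t ht => hX.lineMap_mem_intrinsicInterior hu hx₀ ht
  have hcl : ∀ u : E, Continuous fun t : ℝ => (AffineMap.lineMap u x₀ t : E) :=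
    fun u => AffineMap.lineMap_continuous
  refine le_of_tendsto_of_tendsto
    (hlim _ (hX hx hx' ha hb hab)
      (fun t => a • (AffineMap.lineMap x x₀ t : E) + b • (AffineMap.lineMap x' x₀ t : E))
      (((hcl x).const_smul a).add ((hcl x').const_smul b)) (by simp) fun t ht =>
        hX (intrinsicInterior_subset (hri x hx t ht)) (intrinsicInterior_subset (hri x' hx' t ht))
          ha hb hab)
    (((hlim x hx _ (hcl x) (by simp) fun t ht =>
        intrinsicInterior_subset (hri x hx t ht)).const_smul a).add
      ((hlim x' hx' _ (hcl x') (by simp) fun t ht =>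
        intrinsicInterior_subset (hri x' hx' t ht)).const_smul b)) ?_
  filter_upwards [hIoc] with t ht
  exact (hconv _ (hY.lineMap_mem_intrinsicInterior hy hy₀ ht)).2 (hri x hx t ht)
    (hri x' hx' t ht) ha hb hab

/-- Weak monotonicity of the partial Fréchet subdifferentials in the first variable over the
relative interiors gives weak convexity in the first variable. -/
theorem convexOn_add_sq_of_weaklyMonotone [FiniteDimensional ℝ E] [FiniteDimensional ℝ F]
    {X : Set E} {Y : Set F} (hX : Convex ℝ X) (hY : Convex ℝ Y) {f : E → F → ℝ}
    (hf : ContinuousOn (fun w : E × F => f w.1 w.2) (X ×ˢ Y)) (ρ : ℝ)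
    (hne : ∀ y ∈ intrinsicInterior ℝ Y, ∀ x ∈ intrinsicInterior ℝ X,
      (frechetSubdifferential (fun u => f u y) x).Nonempty)
    (hm : ∀ y ∈ intrinsicInterior ℝ Y, IsWeaklyMonotoneOn ρ (intrinsicInterior ℝ X)
      (frechetSubdifferential fun u => f u y))
    {y : F} (hy : y ∈ Y) : ConvexOn ℝ X fun x => f x y + ρ / 2 * ‖x‖ ^ 2 := by
  have hf' : ContinuousOn (fun w : E × F => f w.1 w.2 + ρ / 2 * ‖w.1‖ ^ 2) (X ×ˢ Y) :=
    hf.add (by fun_prop)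
  refine convexOn_of_convexOn_intrinsicInterior (f := fun x y => f x y + ρ / 2 * ‖x‖ ^ 2)
    hX hY hf' (fun v hv => ?_) hy
  refine convexOn_of_monotone_frechetSubdifferential hX.intrinsicInterior_convex ?_
    (fun x hx => (hne v hv x hx).elim fun ζ hζ => ⟨_, frechetSubdifferential_add_sq hζ ρ⟩) ?_
  · exact hf'.comp (f := fun x => (x, v)) (by fun_prop) fun x hx =>
      ⟨intrinsicInterior_subset hx, intrinsicInterior_subset hv⟩
  · intro x hx x' hx' ζ hζ ζ' hζ'
    -- The shift by `-ρ` undoes the shift by `ρ`.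
    have hsub : ∀ {u η : E}, η ∈ frechetSubdifferential
        (fun u => f u v + ρ / 2 * ‖u‖ ^ 2) u →
        η - ρ • u ∈ frechetSubdifferential (fun u => f u v) u := by
      intro u η hη
      simpa [sub_eq_add_neg, neg_div] using frechetSubdifferential_add_sq hη (-ρ)
    have := hm v hv x hx x' hx' _ (hsub hζ) _ (hsub hζ')
    have he : ζ - ρ • x - (ζ' - ρ • x') = ζ - ζ' - ρ • (x - x') := by module
    rw [he, inner_sub_left, real_inner_smul_left, real_inner_self_eq_norm_sq] at this
    linarith

theorem ConvexOn.add_inner_sub_sq_le_of_mem_frechetSubdifferential {g : E → ℝ} {X : Set E} {ρ : ℝ}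
    (hg : ConvexOn ℝ X fun x => g x + ρ / 2 * ‖x‖ ^ 2) {x x' ζ : E} (hx : x ∈ X) (hx' : x' ∈ X)
    (hζ : ζ ∈ frechetSubdifferential g x) :
    g x + inner ℝ ζ (x' - x) - ρ / 2 * ‖x' - x‖ ^ 2 ≤ g x' := by
  have := hg.add_inner_le_of_mem_frechetSubdifferential hx hx'
    (frechetSubdifferential_add_sq hζ ρ)
  have hsq : ‖x'‖ ^ 2 = ‖x‖ ^ 2 + 2 * inner ℝ x (x' - x) + ‖x' - x‖ ^ 2 := by
    simpa using norm_add_sq_real x (x' - x)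
  rw [inner_add_left, real_inner_smul_left, hsq] at this
  linarith

theorem concaveOn_sub_sq_iff {g : E → ℝ} {X : Set E} {ρ : ℝ} :
    ConcaveOn ℝ X (fun x => g x - ρ / 2 * ‖x‖ ^ 2) ↔
      ConvexOn ℝ X fun x => -g x + ρ / 2 * ‖x‖ ^ 2 := by
  rw [← neg_convexOn_iff]
  have : (-fun x => g x - ρ / 2 * ‖x‖ ^ 2) = fun x => -g x + ρ / 2 * ‖x‖ ^ 2 := by
    ext x
    simp only [Pi.neg_apply]
    ring
  rw [this]

/-! ### The two implications -/

theorem IsWeaklyConvexWeaklyConcaveOn.isWeaklyMonotoneOn {X : Set E} {Y : Set F} {f : E → F → ℝ}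
    {ρ : ℝ} (hf : IsWeaklyConvexWeaklyConcaveOn ρ X Y f) :
    IsWeaklyMonotoneOn ρ (prodSet X Y) (saddleMapping f) := by
  rintro z ⟨hzx, hzy⟩ z' ⟨hzx', hzy'⟩ ξ ⟨hξx, hξy⟩ ξ' ⟨hξx', hξy'⟩
  have h1 := (hf.1 _ hzy).add_inner_sub_sq_le_of_mem_frechetSubdifferential hzx hzx' hξx
  have h2 := (hf.1 _ hzy').add_inner_sub_sq_le_of_mem_frechetSubdifferential hzx' hzx hξx'
  have h3 := (concaveOn_sub_sq_iff.1
    (hf.2 _ hzx)).add_inner_sub_sq_le_of_mem_frechetSubdifferential hzy hzy' hξy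
  have h4 := (concaveOn_sub_sq_iff.1
    (hf.2 _ hzx')).add_inner_sub_sq_le_of_mem_frechetSubdifferential hzy' hzy hξy'
  rw [← neg_sub z.fst z'.fst, inner_neg_right, norm_neg] at h1
  rw [← neg_sub z.snd z'.snd, inner_neg_right, norm_neg] at h3
  rw [WithLp.prod_norm_sq_eq_of_L2, WithLp.prod_inner_apply]
  simp only [WithLp.ofLp_sub, Prod.fst_sub, Prod.snd_sub, WithLp.sub_fst, WithLp.sub_snd,
    inner_sub_left]
  simp only [WithLp.ofLp_fst, WithLp.ofLp_snd]
  linarith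

theorem IsWeaklyMonotoneOn.isWeaklyConvexWeaklyConcaveOn [FiniteDimensional ℝ E]
    [FiniteDimensional ℝ F] {X : Set E} {Y : Set F} (hX : Convex ℝ X) (hY : Convex ℝ Y)
    {f : E → F → ℝ} (hf : ContinuousOn (fun w : E × F => f w.1 w.2) (X ×ˢ Y)) {ρ : ℝ}
    (hne : ∀ z ∈ prodSet (intrinsicInterior ℝ X) (intrinsicInterior ℝ Y),
      (saddleMapping f z).Nonempty)
    (hm : IsWeaklyMonotoneOn ρ (prodSet X Y) (saddleMapping f)) :
    IsWeaklyConvexWeaklyConcaveOn ρ X Y f := by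
  have hne' : ∀ x ∈ intrinsicInterior ℝ X, ∀ y ∈ intrinsicInterior ℝ Y,
      (frechetSubdifferential (fun u => f u y) x).Nonempty ∧
        (frechetSubdifferential (fun v => -f x v) y).Nonempty := by
    intro x hx y hy
    obtain ⟨ξ, h1, h2⟩ := hne (WithLp.toLp 2 (x, y)) ⟨hx, hy⟩
    exact ⟨⟨_, h1⟩, ⟨_, h2⟩⟩
  have hm' : ∀ x ∈ intrinsicInterior ℝ X, ∀ y ∈ intrinsicInterior ℝ Y,
      ∀ x' ∈ intrinsicInterior ℝ X, ∀ y' ∈ intrinsicInterior ℝ Y,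
      ∀ ζ ∈ frechetSubdifferential (fun u => f u y) x,
      ∀ η ∈ frechetSubdifferential (fun v => -f x v) y,
      ∀ ζ' ∈ frechetSubdifferential (fun u => f u y') x',
      ∀ η' ∈ frechetSubdifferential (fun v => -f x' v) y',
      -ρ * (‖x - x'‖ ^ 2 + ‖y - y'‖ ^ 2) ≤
        inner ℝ (ζ - ζ') (x - x') + inner ℝ (η - η') (y - y') := by
    intro x hx y hy x' hx' y' hy' ζ hζ η hη ζ' hζ' η' hη'
    have := hm (WithLp.toLp 2 (x, y)) ⟨intrinsicInterior_subset hx, intrinsicInterior_subset hy⟩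
      (WithLp.toLp 2 (x', y')) ⟨intrinsicInterior_subset hx', intrinsicInterior_subset hy'⟩
      (WithLp.toLp 2 (ζ, η)) ⟨hζ, hη⟩ (WithLp.toLp 2 (ζ', η')) ⟨hζ', hη'⟩
    rwa [WithLp.prod_norm_sq_eq_of_L2, WithLp.prod_inner_apply] at this
  refine ⟨fun y hy => ?_, fun x hx => concaveOn_sub_sq_iff.2 ?_⟩
  · refine convexOn_add_sq_of_weaklyMonotone hX hY hf ρ (fun v hv u hu => (hne' u hu v hv).1)
      (fun v hv u hu u' hu' ζ hζ ζ' hζ' => ?_) hy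
    -- Elements of the product mapping need a second component, although it is paired with `v - v =
    -- 0`.
    obtain ⟨η, hη⟩ := (hne' u hu v hv).2
    obtain ⟨η', hη'⟩ := (hne' u' hu' v hv).2
    simpa using hm' u hu v hv u' hu' v hv ζ hζ η hη ζ' hζ' η' hη'
  · have hf' : ContinuousOn (fun w : F × E => -f w.2 w.1) (Y ×ˢ X) :=
      (hf.comp continuous_swap.continuousOn fun w hw => ⟨hw.2, hw.1⟩).neg
    refine convexOn_add_sq_of_weaklyMonotone (f := fun v u => -f u v) hY hX hf' ρ
      (fun u hu v hv => (hne' u hu v hv).2) (fun u hu v hv v' hv' η hη η' hη' => ?_) hx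
    obtain ⟨ζ, hζ⟩ := (hne' u hu v hv).1
    obtain ⟨ζ', hζ'⟩ := (hne' u hu v' hv').1
    simpa using hm' u hu v hv u hu v' hv' ζ hζ η hη ζ' hζ' η' hη'

end Subdifferential

theorem lemma1 (p q : ℕ)
    (X : Set (EuclideanSpace ℝ (Fin p))) (Y : Set (EuclideanSpace ℝ (Fin q)))
    (hXclosed : IsClosed X) (hXconvex : Convex ℝ X)
    (hYclosed : IsClosed Y) (hYconvex : Convex ℝ Y)
    (f : EuclideanSpace ℝ (Fin p) → EuclideanSpace ℝ (Fin q) → ℝ)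
    (hf : ContinuousOn (fun w : EuclideanSpace ℝ (Fin p) × EuclideanSpace ℝ (Fin q) =>
      f w.1 w.2) (X ×ˢ Y))
    (ρ : ℝ) (hρ : 0 < ρ) :
    (IsWeaklyConvexWeaklyConcaveOn ρ X Y f →
        IsWeaklyMonotoneOn ρ (prodSet X Y) (saddleMapping f)) ∧
      ((∀ z ∈ prodSet (intrinsicInterior ℝ X) (intrinsicInterior ℝ Y),
          (saddleMapping f z).Nonempty) →
        IsWeaklyMonotoneOn ρ (prodSet X Y) (saddleMapping f) →
          IsWeaklyConvexWeaklyConcaveOn ρ X Y f) :=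
  ⟨fun h => h.isWeaklyMonotoneOn, fun hne hm =>
    hm.isWeaklyConvexWeaklyConcaveOn hXconvex hYconvex hf hne⟩
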